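/- \textbf{Theorem (twisted periodicity of noncommutative birational rowmotion on the $p\times q$-rectangle).} Let $\mathbb{K}$ be an arbitrary associative ring with unity (not necessarily commutative). For an invertible $a\in\mathbb{K}$, write $\overline{a}$ for its inverse. For a finite poset $P$, let $\widehat{P}$ be the poset obtained from $P$ by adjoining a new least element $0$ and a new greatest element $1$. A \emph{$\mathbb{K}$-labeling} of $P$ is an arbitrary map $f:\widehat{P}\to\mathbb{K}$. For each $v\in P$, the \emph{toggle} $T_v$ is the partial map on the set of $\mathbb{K}$-labelings that replaces the label of $f$ at $v$ by $$\Bigl(\sum_{u\in\widehat{P},\ u\lessdot v} f(u)\Bigr)\cdot\overline{f(v)}\cdot\overline{\sum_{u\in\widehat{P},\ u\gtrdot v}\overline{f(u)}}$$ and keeps all other labels unchanged; here $\lessdot$ is the covering relation of $\widehat{P}$, and $T_v f$ is undefined if any of the inverses in this formula does not exist. \emph{Birational rowmotion} of $P$ is the partial map $R=T_{v_1}\circ T_{v_2}\circ\cdots\circ T_{v_m}$, where $(v_1,v_2,\ldots,v_m)$ is a linear extension of $P$, i.e. a list containing each element of $P$ exactly once such that $v_i<v_j$ implies $i<j$; this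 partial map does not depend on the choice of the linear extension. Its powers are formed by composing partial maps (a composition is undefined as soon as one of its steps is). Let $p$ and $q$ be positive integers, and let $P=[p]\times[q]$ be the product of the chains $[p]=\{1<2<\cdots<p\}$ and $[q]=\{1<2<\cdots<q\}$, with the entrywise order. Let $f:\widehat{P}\to\mathbb{K}$ be a $\mathbb{K}$-labeling of $P$ such that $R^{p+q}f$ is defined. Set $a=f(0)$ and $b=f(1)$. Then $a$ and $b$ are invertible, and for every $x\in\widehat{P}$ we have $$\bigl(R^{p+q}f\bigr)(x)=a\,\overline{b}\cdot f(x)\cdot\overline{a}\,b.$$ -/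

import Mathlib

namespace NoncommRowmotion

/-- A partial map from `X` to `Y`: a map from `X` to `Y` together with one extra element `none`,
which stands for an undefined value. -/
abbrev PartialMap (X Y : Type*) := X → Option Y

namespace PartialMap

/-- The identity, as a partial map. -/
def id (X : Type*) : PartialMap X X := fun x => some x

/-- The composition `F ∘ G` of partial maps: `G` is applied first, and the result is undefined as
soon as one of the two steps is undefined. -/
def comp {X Y Z : Type*} (F : PartialMap Y Z) (G : PartialMap X Y) : PartialMap X Z :=
  fun x => (G x).bind F

/-- The `k`-fold composition `F ∘ F ∘ ⋯ ∘ F` of a partial map with itself. -/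
def iterate {X : Type*} (F : PartialMap X X) : ℕ → PartialMap X X
  | 0 => id X
  | k + 1 => comp F (iterate F k)

end PartialMap

/-- The poset `P` with a new least element `⊥` (written `0` in the literature on rowmotion) and a
new greatest element `⊤` (written `1`). -/
abbrev Hat (P : Type*) := WithBot (WithTop P)

/-- A `K`-labeling of `P` is an arbitrary map from the extended poset to `K`. -/
abbrev Labeling (P K : Type*) := Hat P → K

/-- The canonical inclusion of `P` into the extended poset. -/
def toHat {P : Type*} (v : P) : Hat P := ((v : WithTop P) : WithBot (WithTop P))

section Toggle

variable {P K : Type*} [PartialOrder P] [Fintype P] [Ring K]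

open Classical in
/-- The sum of the labels at all elements covered by `v`. -/
noncomputable def lowerSum (f : Labeling P K) (v : Hat P) : K :=
  ∑ u : Hat P with u ⋖ v, f u

open Classical in
/-- The sum of the inverses of the labels at all elements covering `v`. -/
noncomputable def upperInvSum (f : Labeling P K) (v : Hat P) : K :=
  ∑ u : Hat P with v ⋖ u, Ring.inverse (f u)

/-- All the inverses that occur in the formula for the toggle at `v` exist. -/
def ToggleDefined (f : Labeling P K) (v : Hat P) : Prop :=
  IsUnit (f v) ∧ (∀ u : Hat P, v ⋖ u → IsUnit (f u)) ∧ IsUnit (upperInvSum f v)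

open Classical in
/-- The (noncommutative birational) toggle at `v`. It changes only the label at `v`, and it is
undefined if one of the inverses in the formula for the new label does not exist. -/
noncomputable def toggle (v : P) : PartialMap (Labeling P K) (Labeling P K) := fun f =>
  if ToggleDefined f (toHat v) then
    some (fun w => if w = toHat v then
      lowerSum f (toHat v) * Ring.inverse (f (toHat v)) * Ring.inverse (upperInvSum f (toHat v))
      else f w)
  else none

/-- The composition `T_{v₁} ∘ T_{v₂} ∘ ⋯ ∘ T_{vₘ}` of the toggles at the entries of a list
(so the toggle at the last entry is applied first). -/
noncomputable def toggleList : List P → PartialMap (Labeling P K) (Labeling P K)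
  | [] => PartialMap.id _
  | v :: l => PartialMap.comp (toggle v) (toggleList l)

end Toggle

/-- A linear extension of `P`: a list in which each element of `P` occurs exactly once, and in which
smaller elements of `P` occur before larger ones. -/
structure IsLinearExtension {P : Type*} [PartialOrder P] (l : List P) : Prop where
  nodup : l.Nodup
  mem_all : ∀ v : P, v ∈ l
  index_lt : ∀ i j : Fin l.length, l.get i < l.get j → i < j

section WellDefined

theorem isLinearExtension_index_iff {P : Type*} [PartialOrder P] (l : List P) :
    (∀ i j : Fin l.length, l.get i < l.get j → i < j) ↔ l.Pairwise (fun x y => ¬ y < x) := by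
  rw [List.pairwise_iff_get]
  constructor
  · intro h i j hij hlt
    exact absurd (h j i hlt) (not_lt.mpr hij.le)
  · intro h i j hlt
    rcases lt_trichotomy i j with h1 | h1 | h1
    · exact h1
    · subst h1
      exact absurd hlt (lt_irrefl _)
    · exact absurd hlt (h j i h1)

theorem exists_isLinearExtension (P : Type*) [PartialOrder P] [Fintype P] :
    ∃ l : List P, IsLinearExtension l := by
  classical
  have key : ∀ s : Finset P, ∃ l : List P, l.Nodup ∧ (∀ v, v ∈ l ↔ v ∈ s) ∧
      l.Pairwise (fun x y => ¬ y < x) := by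
    intro s
    induction s using Finset.strongInduction with
    | H s ih =>
      rcases s.eq_empty_or_nonempty with rfl | hs
      · exact ⟨[], by simp⟩
      · obtain ⟨m, hm⟩ := s.exists_minimal hs
        obtain ⟨l, h1, h2, h3⟩ := ih (s.erase m) (Finset.erase_ssubset hm.prop)
        refine ⟨m :: l, ?_, ?_, ?_⟩
        · rw [List.nodup_cons]
          exact ⟨by simp [h2], h1⟩
        · intro v
          by_cases hv : v = m
          · simp [hv, hm.prop]
          · simp [h2, hv]
        · rw [List.pairwise_cons]
          refine ⟨fun y hy => ?_, h3⟩
          have hys : y ∈ s := Finset.mem_of_mem_erase ((h2 y).mp hy)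
          exact hm.not_lt hys
  obtain ⟨l, h1, h2, h3⟩ := key Finset.univ
  exact ⟨l, h1, fun v => (h2 v).mpr (Finset.mem_univ v), (isLinearExtension_index_iff l).mpr h3⟩

theorem toHat_injective {P : Type*} : Function.Injective (toHat (P := P)) := by
  intro v w h
  simpa [toHat] using h

theorem toHat_lt {P : Type*} [PartialOrder P] {v w : P} : toHat v < toHat w ↔ v < w := by
  simp [toHat]

variable {P K : Type*} [PartialOrder P] [Fintype P] [Ring K]

theorem toggle_comm {v w : P} (h1 : ¬ v < w) (h2 : ¬ w < v) :
    PartialMap.comp (toggle v) (toggle w) =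
      PartialMap.comp (toggle w) (toggle (P := P) (K := K) v) := by
  classical
  rcases eq_or_ne v w with rfl | hne
  · rfl
  have hne' : toHat v ≠ toHat w := fun h => hne (toHat_injective h)
  have aux : ∀ (x y : P), toHat x ≠ toHat y → ¬ x < y → ¬ y < x → ∀ (f : Labeling P K) (c : K),
      (ToggleDefined (fun z => if z = toHat x then c else f z) (toHat y) ↔
        ToggleDefined f (toHat y)) ∧
      lowerSum (fun z => if z = toHat x then c else f z) (toHat y) = lowerSum f (toHat y) ∧
      upperInvSum (fun z => if z = toHat x then c else f z) (toHat y) =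
        upperInvSum f (toHat y) := by
    intro x y hxy hx hy f c
    have e1 : ∀ u : Hat P, u ⋖ toHat y → u ≠ toHat x := by
      rintro u hu rfl
      exact hx (toHat_lt.mp hu.lt)
    have e2 : ∀ u : Hat P, toHat y ⋖ u → u ≠ toHat x := by
      rintro u hu rfl
      exact hy (toHat_lt.mp hu.lt)
    have l1 : lowerSum (fun z => if z = toHat x then c else f z) (toHat y) =
        lowerSum f (toHat y) := by
      unfold lowerSum
      refine Finset.sum_congr rfl fun u hu => ?_
      exact if_neg (e1 u (by simpa using hu))
    have l2 : upperInvSum (fun z => if z = toHat x then c else f z) (toHat y) =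
        upperInvSum f (toHat y) := by
      unfold upperInvSum
      refine Finset.sum_congr rfl fun u hu => ?_
      exact congrArg Ring.inverse (if_neg (e2 u (by simpa using hu)))
    refine ⟨?_, l1, l2⟩
    unfold ToggleDefined
    simp only [l2, if_neg hxy.symm]
    refine and_congr_right fun _ => and_congr_left fun _ => forall₂_congr fun u hu => ?_
    rw [if_neg (e2 u hu)]
  funext f
  have av := fun c => aux v w hne' h1 h2 f c
  have aw := fun c => aux w v hne'.symm h2 h1 f c
  unfold PartialMap.comp toggle
  by_cases dv : ToggleDefined f (toHat v) <;> by_cases dw : ToggleDefined f (toHat w)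
  · rw [if_pos dv, if_pos dw, Option.bind_some, Option.bind_some]
    simp only [(av _).1, (aw _).1, (av _).2.1, (aw _).2.1, (av _).2.2, (aw _).2.2, if_pos dv,
      if_pos dw, if_neg hne', if_neg hne'.symm]
    congr 1
    funext z
    by_cases hz : z = toHat v
    · subst hz
      simp [hne']
    · simp [hz]
  · rw [if_pos dv, if_neg dw, Option.bind_some, Option.bind_none]
    simp only [(av _).1, if_neg dw]
  · rw [if_neg dv, if_pos dw, Option.bind_some, Option.bind_none]
    simp only [(aw _).1, if_neg dv]
  · rw [if_neg dv, if_neg dw]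
    rfl

theorem comp_assoc {X Y Z W : Type*} (F : PartialMap Z W) (G : PartialMap Y Z)
    (H : PartialMap X Y) :
    PartialMap.comp (PartialMap.comp F G) H = PartialMap.comp F (PartialMap.comp G H) := by
  funext x
  simp only [PartialMap.comp]
  cases H x <;> rfl

theorem toggleList_move (v : P) (l₁ l₂ : List P) (h : ∀ w ∈ l₁, ¬ v < w ∧ ¬ w < v) :
    toggleList (K := K) (l₁ ++ v :: l₂) = toggleList (v :: (l₁ ++ l₂)) := by
  induction l₁ with
  | nil => rfl
  | cons w l ih =>
    have hw := h w (by simp)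
    have ih' := ih fun u hu => h u (by simp [hu])
    simp only [List.cons_append, toggleList] at ih' ⊢
    rw [ih', ← comp_assoc, ← comp_assoc, toggle_comm hw.2 hw.1]

theorem toggleList_perm : ∀ (l m : List P), l.Perm m → m.Nodup →
    l.Pairwise (fun x y => ¬ y < x) → m.Pairwise (fun x y => ¬ y < x) →
    toggleList (K := K) l = toggleList m := by
  intro l
  induction l with
  | nil =>
    intro m hp _ _ _
    rw [List.nil_perm.mp hp]
  | cons v l ih =>
    intro m hp hn hl hm
    obtain ⟨m₁, m₂, rfl⟩ := List.append_of_mem (hp.subset (List.mem_cons_self))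
    have hp' : l.Perm (m₁ ++ m₂) :=
      List.Perm.cons_inv (hp.trans List.perm_middle)
    rw [List.pairwise_cons] at hl
    rw [List.pairwise_append, List.pairwise_cons] at hm
    rw [toggleList_move v m₁ m₂]
    · simp only [toggleList]
      rw [ih (m₁ ++ m₂) hp' ((List.nodup_middle.mp hn).of_cons) hl.2]
      rw [List.pairwise_append]
      exact ⟨hm.1, hm.2.1.2, fun a ha b hb => hm.2.2 a ha b (List.mem_cons_of_mem _ hb)⟩
    · intro w hw
      refine ⟨hm.2.2 w hw v List.mem_cons_self, ?_⟩
      exact hl.1 w (hp'.symm.subset (List.mem_append_left _ hw))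

/-- The composition of the toggles along a linear extension does not depend on the linear
extension. -/
theorem toggleList_eq_of_isLinearExtension {l m : List P} (hl : IsLinearExtension l)
    (hm : IsLinearExtension m) : toggleList (K := K) l = toggleList m := by
  refine toggleList_perm l m ?_ hm.nodup ((isLinearExtension_index_iff l).mp hl.index_lt)
    ((isLinearExtension_index_iff m).mp hm.index_lt)
  exact (List.perm_ext_iff_of_nodup hl.nodup hm.nodup).mpr
    fun a => ⟨fun _ => hm.mem_all a, fun _ => hl.mem_all a⟩

end WellDefined

/-- (Noncommutative) birational rowmotion of the finite poset `P`: the composition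
`T_{v₁} ∘ T_{v₂} ∘ ⋯ ∘ T_{vₘ}` of toggles along a linear extension `(v₁, v₂, …, vₘ)` of `P`. -/
noncomputable def rowmotion (P K : Type*) [PartialOrder P] [Fintype P] [Ring K] :
    PartialMap (Labeling P K) (Labeling P K) :=
  toggleList (exists_isLinearExtension P).choose

/-- Every linear extension of `P` can be used to compute birational rowmotion. -/
theorem rowmotion_eq_toggleList {P K : Type*} [PartialOrder P] [Fintype P] [Ring K] {l : List P}
    (hl : IsLinearExtension l) : rowmotion P K = toggleList l :=
  toggleList_eq_of_isLinearExtension (exists_isLinearExtension P).choose_spec hl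

end NoncommRowmotion

/-! Write `F t` for the labels along the orbit and `G t` for their inverses. At every `v` a step of
rowmotion says: (new label) · (sum of new inverse labels above `v`) · (old label) = (sum of old
labels below `v`). Rearranged, the down weights at one time are the up weights at the next
(`upWeight_eq_downWeight`). Sums over lattice paths turn weights back into labels: down weights give
the labels (`label_eq_pathSum_mul`), up weights the inverse labels on the lower edge
(`inverse_label_eq_mul_pathSum`). Within one labeling, down path sums starting on the upper edge
equal up path sums with both ends moved by one (`pathSum_downWeight_eq`). Alternating this with the
passage between times slides paths along the edge, so that inverse labels at `(i, 1)` match earlier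
labels at `(p + 1 - i, q)`. The step equations extend this, by induction on `j`, to antipodal
reciprocity (`reciprocity`): the inverse label at `(i, j)` at time `t + i + j - 1` is the label at
`(p + 1 - i, q + 1 - j)` at time `t`, multiplied by the inverse of `b` on the left and of `a` on the
right. Applying it twice returns to the same point after `p + q` steps and leaves exactly the twist
by `a` and `b`. -/

namespace NoncommRowmotion

/-! ### Noncommutative path sums for a single labeling. -/

section Algebra

variable {K : Type*} [Ring K]

/-- The sum of the products of the weights `W` along the lattice paths which descend from `(x, y)`
to `(i, 1)` by steps `(-1, 0)` and `(0, -1)`, computed by a recursion on the starting point. -/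
def pathSum (W : ℕ → ℕ → K) (i : ℕ) : ℕ → ℕ → K
  | x, 0 => if x = i then 1 else 0
  | 0, _ + 1 => 0
  | x + 1, y + 1 => W (x + 1) (y + 1) * (pathSum W i x (y + 1) + pathSum W i (x + 1) y)
termination_by x y => x + y

theorem pathSum_zero_right (W : ℕ → ℕ → K) (i x : ℕ) :
    pathSum W i x 0 = if x = i then 1 else 0 := by
  rw [pathSum]

theorem pathSum_zero_left (W : ℕ → ℕ → K) (i y : ℕ) (hi : 0 < i) : pathSum W i 0 y = 0 := by
  cases y with
  | zero => rw [pathSum, if_neg hi.ne]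
  | succ y => rw [pathSum]

theorem pathSum_succ_succ (W : ℕ → ℕ → K) (i x y : ℕ) :
    pathSum W i (x + 1) (y + 1) =
      W (x + 1) (y + 1) * (pathSum W i x (y + 1) + pathSum W i (x + 1) y) := by
  rw [pathSum]

/-- Solutions of the path recursion with the right boundary values are path sums. -/
theorem eq_pathSum_mul {W c : ℕ → ℕ → K} {m n i : ℕ} (hi : 0 < i) (s : K)
    (h0 : ∀ y ≤ n, c 0 y = 0) (h1 : ∀ x ≤ m, c x 0 = if x = i then s else 0)
    (h : ∀ x < m, ∀ y < n,
      c (x + 1) (y + 1) = W (x + 1) (y + 1) * (c x (y + 1) + c (x + 1) y)) :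
    ∀ x ≤ m, ∀ y ≤ n, c x y = pathSum W i x y * s := by
  intro x
  induction x with
  | zero =>
    intro _ y hy
    rw [pathSum_zero_left _ _ _ hi, h0 y hy, zero_mul]
  | succ x ihx =>
    intro hx y
    induction y with
    | zero =>
      intro _
      rw [h1 _ hx, pathSum_zero_right]
      split_ifs <;> simp
    | succ y ihy =>
      intro hy
      rw [h x (by omega) y (by omega), pathSum_succ_succ, ihx (by omega) _ hy, ihy (by omega),
        mul_assoc, add_mul]

theorem pathSum_congr {W W' : ℕ → ℕ → K} {m n i : ℕ} (hi : 0 < i)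
    (h : ∀ x < m, ∀ y < n, W (x + 1) (y + 1) = W' (x + 1) (y + 1)) :
    ∀ x ≤ m, ∀ y ≤ n, pathSum W i x y = pathSum W' i x y := by
  intro x hx y hy
  rw [eq_pathSum_mul (W := W') (c := pathSum W i) (m := m) (n := n) hi 1 _ _ _ x hx y hy, mul_one]
  · exact fun y _ => pathSum_zero_left _ _ _ hi
  · exact fun x _ => pathSum_zero_right _ _ _
  · intro x hx y hy
    rw [pathSum_succ_succ, h x hx y hy]

/-- The weights `f(v)` times the inverse of the sum of the labels below `v`. -/
noncomputable def downWeight (f : ℕ → ℕ → K) (i j : ℕ) : K :=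
  f i j * Ring.inverse (f (i - 1) j + f i (j - 1))

/-- The weights formed by the inverse of the sum of the inverse labels `g` above `v`, times
`g(v)`. -/
noncomputable def upWeight (g : ℕ → ℕ → K) (i j : ℕ) : K :=
  Ring.inverse (g (i + 1) j + g i (j + 1)) * g i j

/-- A label is recovered from the path sums of the down weights. -/
theorem label_eq_pathSum_mul {f : ℕ → ℕ → K} {p q : ℕ} {a : K}
    (h0 : ∀ y, f 0 y = 0) (h1 : ∀ x, f x 0 = if x = 1 then a else 0)
    (hu : ∀ x < p, ∀ y < q, IsUnit (f x (y + 1) + f (x + 1) y)) :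
    ∀ x ≤ p, ∀ y ≤ q, f x y = pathSum (downWeight f) 1 x y * a := by
  refine eq_pathSum_mul one_pos a (fun y _ => h0 y) (fun x _ => h1 x) fun x hx y hy => ?_
  simp only [downWeight, Nat.add_sub_cancel]
  rw [mul_assoc, Ring.inverse_mul_cancel _ (hu x hx y hy), mul_one]

/-- The inverse labels on the edge are recovered from the path sums of the up weights. -/
theorem inverse_label_eq_mul_pathSum {g : ℕ → ℕ → K} {p q i : ℕ} {b' : K}
    (hq : 0 < q) (hi : 0 < i) (hip : i ≤ p)
    (h0 : ∀ y, g (p + 1) y = if y = q then b' else 0) (h1 : ∀ x ≤ p, g x (q + 1) = 0)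
    (hu : ∀ x < p, ∀ y < q, IsUnit (g (x + 2) (y + 1) + g (x + 1) (y + 2))) :
    g i 1 = b' * pathSum (upWeight g) i p q := by
  set P := pathSum (upWeight g) i with hP
  -- The path recursion, multiplied by the upper sum, is a conservation law: a difference in `x`
  -- plus a difference in `y` vanishes. Summed over the rectangle, only boundary terms survive.
  have key : ∀ x ∈ Finset.range p, ∀ y ∈ Finset.range q,
      (g (x + 2) (y + 1) * P (x + 1) (y + 1) - g (x + 1) (y + 1) * P x (y + 1)) +
      (g (x + 1) (y + 2) * P (x + 1) (y + 1) - g (x + 1) (y + 1) * P (x + 1) y) = 0 := by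
    intro x hx y hy
    have e : (g (x + 2) (y + 1) + g (x + 1) (y + 2)) * P (x + 1) (y + 1) =
        g (x + 1) (y + 1) * (P x (y + 1) + P (x + 1) y) := by
      rw [hP, pathSum_succ_succ, upWeight, mul_assoc, ← mul_assoc,
        Ring.mul_inverse_cancel _ (hu x (Finset.mem_range.mp hx) y (Finset.mem_range.mp hy)),
        one_mul]
    rw [add_mul, mul_add] at e
    rw [sub_add_sub_comm, e, sub_self]
  have tot := Finset.sum_eq_zero fun x hx => Finset.sum_eq_zero (key x hx)
  simp only [Finset.sum_add_distrib] at tot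
  rw [Finset.sum_comm] at tot
  have e1 : ∀ y, ∑ x ∈ Finset.range p,
      (g (x + 2) (y + 1) * P (x + 1) (y + 1) - g (x + 1) (y + 1) * P x (y + 1)) =
      g (p + 1) (y + 1) * P p (y + 1) := by
    intro y
    rw [Finset.sum_range_sub (fun x => g (x + 1) (y + 1) * P x (y + 1)), hP,
      pathSum_zero_left _ _ _ hi, mul_zero, sub_zero]
  have e2 : ∀ x ∈ Finset.range p, ∑ y ∈ Finset.range q,
      (g (x + 1) (y + 2) * P (x + 1) (y + 1) - g (x + 1) (y + 1) * P (x + 1) y) =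
      - (if i - 1 = x then g (x + 1) 1 else 0) := by
    intro x hx
    have hx := Finset.mem_range.mp hx
    rw [Finset.sum_range_sub (fun y => g (x + 1) (y + 1) * P (x + 1) y), h1 _ (by omega), hP,
      pathSum_zero_right, zero_mul, zero_sub, zero_add]
    congr 1
    by_cases h : x + 1 = i
    · rw [if_pos h, if_pos (by omega), mul_one]
    · rw [if_neg h, if_neg (by omega), mul_zero]
  rw [Finset.sum_congr rfl e2, Finset.sum_congr rfl fun y _ => e1 y, Finset.sum_neg_distrib,
    Finset.sum_ite_eq, if_pos (Finset.mem_range.mpr (by omega)), Nat.sub_add_cancel hi,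
    ← sub_eq_add_neg, sub_eq_zero] at tot
  rw [← tot, Finset.sum_eq_single (q - 1)]
  · rw [Nat.sub_add_cancel hq, h0, if_pos rfl]
  · intro y _ hy
    rw [h0, if_neg (by omega), zero_mul]
  · intro h
    exact absurd (Finset.mem_range.mpr (by omega)) h

/-- Path sums of down weights which start on the upper edge are path sums of up weights between
the neighbouring points. -/
theorem pathSum_downWeight_eq {f g : ℕ → ℕ → K} {p q i : ℕ} {a : K} (hi : 0 < i)
    (hgf : ∀ x < p, ∀ y < q, g (x + 1) (y + 1) * f (x + 1) (y + 1) = 1)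
    (f1 : ∀ x, f x 0 = if x = 1 then a else 0)
    (g1 : ∀ x ≤ p, g x (q + 1) = 0)
    (hl : ∀ x < p, ∀ y < q, IsUnit (f x (y + 1) + f (x + 1) y))
    (hu : ∀ x < p, ∀ y < q, IsUnit (g (x + 2) (y + 1) + g (x + 1) (y + 2)))
    {x : ℕ} (hx : x < p) :
    pathSum (downWeight f) (i + 1) (x + 1) q = pathSum (upWeight g) i x q := by
  obtain ⟨m, rfl⟩ : ∃ m, p = m + 1 := ⟨p - 1, by omega⟩
  set P := pathSum (downWeight f) (i + 1) with hP
  have P0 : ∀ y, P 0 y = 0 := fun y => pathSum_zero_left _ _ _ i.succ_pos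
  have P1 : ∀ y, P 1 y = 0 := by
    intro y
    induction y with
    | zero => rw [hP, pathSum_zero_right, if_neg (by omega)]
    | succ y ih => rw [hP, pathSum_succ_succ, ← hP, P0, ih, add_zero, mul_zero]
  -- `c` measures how far the two summands of `P` below `(x + 1, y + 1)` are from being split in
  -- proportion to the labels `f` there. Hence it has a second form `hc`, seen from the other lower
  -- neighbour. On the upper edge the correction vanishes, leaving `P (x + 1) q`.
  let c : ℕ → ℕ → K := fun x y => P (x + 1) y - f (x + 1) y * (g (x + 1) (y + 1) * P (x + 1) (y + 1))
  have hc : ∀ x < m + 1, ∀ y < q,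
      c x y = f x (y + 1) * (g (x + 1) (y + 1) * P (x + 1) (y + 1)) - P x (y + 1) := by
    intro x hx y hy
    have e : (f x (y + 1) + f (x + 1) y) * (g (x + 1) (y + 1) * P (x + 1) (y + 1)) =
        P x (y + 1) + P (x + 1) y := by
      rw [hP, pathSum_succ_succ, downWeight, Nat.add_sub_cancel, Nat.add_sub_cancel,
        ← mul_assoc (g _ _), ← mul_assoc (g _ _), hgf x hx y hy, one_mul, ← mul_assoc,
        Ring.mul_inverse_cancel _ (hl x hx y hy), one_mul]
    rw [add_mul] at e
    simp only [c]
    rw [sub_eq_sub_iff_add_eq_add, add_comm (P _ _), ← e, add_comm]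
  have hcq : ∀ x ≤ m, c x q = P (x + 1) q := by
    intro x hx
    simp only [c]
    rw [g1 _ (by omega), zero_mul, mul_zero, sub_zero]
  have main := eq_pathSum_mul (W := upWeight g) (c := c) (m := m) (n := q) hi 1 ?_ ?_ ?_ x
    (by omega) q le_rfl
  · rw [mul_one, hcq x (by omega)] at main
    exact main
  · intro y _
    simp only [c]
    rw [zero_add, P1, P1, mul_zero, mul_zero, sub_zero]
  · intro x _
    simp only [c]
    rcases Nat.eq_zero_or_pos x with rfl | h
    · rw [zero_add, P1, P1, mul_zero, mul_zero, sub_zero, if_neg hi.ne]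
    · rw [f1, if_neg (by omega), zero_mul, sub_zero, hP, pathSum_zero_right]
      simp
  · intro x hx y hy
    have hx' : x < m + 1 := by omega
    -- Using one form of `c` for each upper neighbour makes the diagonal term at `(x + 2, y + 2)`
    -- cancel. On the edge `y + 1 = q`, where `hc` is not available, that term is zero.
    have e : (g (x + 2) (y + 1) + g (x + 1) (y + 2)) * c (x + 1) (y + 1) =
        g (x + 2) (y + 1) * P (x + 2) (y + 1) - g (x + 1) (y + 2) * P (x + 1) (y + 2) := by
      have e1 : g (x + 2) (y + 1) * c (x + 1) (y + 1) =
          g (x + 2) (y + 1) * P (x + 2) (y + 1) - g (x + 2) (y + 2) * P (x + 2) (y + 2) := by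
        simp only [c]
        rw [mul_sub, ← mul_assoc (g _ _) (f _ _), hgf (x + 1) (by omega) y hy, one_mul]
      have e2 : g (x + 1) (y + 2) * c (x + 1) (y + 1) =
          g (x + 2) (y + 2) * P (x + 2) (y + 2) - g (x + 1) (y + 2) * P (x + 1) (y + 2) := by
        rcases eq_or_lt_of_le (Nat.succ_le_of_lt hy) with h | h
        · have h : y + 2 = q + 1 := by omega
          rw [h, g1 _ (by omega), g1 _ (by omega)]
          simp
        · rw [hc (x + 1) (by omega) (y + 1) h, mul_sub, ← mul_assoc (g _ _) (f _ _),
            hgf x hx' (y + 1) h, one_mul]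
      rw [add_mul, e1, e2, sub_add_sub_cancel]
    have e' : c x (y + 1) + c (x + 1) y = f (x + 1) (y + 1) *
        ((g (x + 2) (y + 1) + g (x + 1) (y + 2)) * c (x + 1) (y + 1)) := by
      rw [e, mul_sub, hc (x + 1) (by omega) y hy]
      simp only [c]
      abel
    rw [e', upWeight, mul_assoc, ← mul_assoc (g _ _) (f _ _), hgf x hx' y hy, one_mul, ← mul_assoc,
      Ring.inverse_mul_cancel _ (hu x hx' y hy), one_mul]

end Algebra

/-! ### Reciprocity and periodicity in coordinates. -/

/-- An orbit of birational rowmotion on the rectangle, in coordinates: `F t i j` is the label at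
`(i, j)` after `t` steps and `G t i j` is its inverse, for `1 ≤ i ≤ p`, `1 ≤ j ≤ q` and `t ≤ N`.
The values on the boundary encode the labels `a` at the bottom and `b` at the top, the latter by
its inverse `b'`. -/
structure IsRectangleOrbit {K : Type*} [Ring K] (p q N : ℕ) (a b b' : K)
    (F G : ℕ → ℕ → ℕ → K) : Prop where
  mul_inv : ∀ t ≤ N, ∀ x < p, ∀ y < q, F t (x + 1) (y + 1) * G t (x + 1) (y + 1) = 1
  inv_mul : ∀ t ≤ N, ∀ x < p, ∀ y < q, G t (x + 1) (y + 1) * F t (x + 1) (y + 1) = 1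
  bot_left : ∀ t y, F t 0 y = 0
  bot_right : ∀ t ≤ N, ∀ x, F t x 0 = if x = 1 then a else 0
  top_left : ∀ t ≤ N, ∀ y, G t (p + 1) y = if y = q then b' else 0
  top_right : ∀ t, ∀ x ≤ p, G t x (q + 1) = 0
  top_mul_inv : b * b' = 1
  top_inv_mul : b' * b = 1
  isUnit_lower : ∀ t < N, ∀ x < p, ∀ y < q, IsUnit (F t x (y + 1) + F t (x + 1) y)
  isUnit_upper : ∀ t < N, ∀ x < p, ∀ y < q,
    IsUnit (G (t + 1) (x + 2) (y + 1) + G (t + 1) (x + 1) (y + 2))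
  step : ∀ t < N, ∀ x < p, ∀ y < q,
    F (t + 1) (x + 1) (y + 1) * (G (t + 1) (x + 2) (y + 1) + G (t + 1) (x + 1) (y + 2)) *
      F t (x + 1) (y + 1) = F t x (y + 1) + F t (x + 1) y

namespace IsRectangleOrbit

variable {K : Type*} [Ring K] {p q N : ℕ} {a b b' : K} {F G : ℕ → ℕ → ℕ → K}

/-- This is the step equation solved for its middle factor, and the only link between path sums at
consecutive times. -/
theorem upWeight_eq_downWeight (h : IsRectangleOrbit p q N a b b' F G) {t : ℕ} (ht : t < N)
    (x : ℕ) (hx : x < p) (y : ℕ) (hy : y < q) :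
    upWeight (G (t + 1)) (x + 1) (y + 1) = downWeight (F t) (x + 1) (y + 1) := by
  simp only [upWeight, downWeight, Nat.add_sub_cancel]
  have hU := h.isUnit_upper t ht x hx y hy
  have hL := h.isUnit_lower t ht x hx y hy
  have hs := h.step t ht x hx y hy
  set u := G (t + 1) (x + 2) (y + 1) + G (t + 1) (x + 1) (y + 2)
  set l := F t x (y + 1) + F t (x + 1) y
  have e : u * F t (x + 1) (y + 1) = G (t + 1) (x + 1) (y + 1) * l := by
    rw [← hs, mul_assoc, ← mul_assoc (G _ _ _), h.inv_mul (t + 1) ht x hx y hy, one_mul]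
  calc Ring.inverse u * G (t + 1) (x + 1) (y + 1)
      = Ring.inverse u * (G (t + 1) (x + 1) (y + 1) * l) * Ring.inverse l := by
        rw [mul_assoc, mul_assoc, Ring.mul_inverse_cancel _ hL, mul_one]
    _ = F t (x + 1) (y + 1) * Ring.inverse l := by
        rw [← e, ← mul_assoc (Ring.inverse u), Ring.inverse_mul_cancel _ hU, one_mul]

/-- Path sums of down weights are transported along the upper edge as time goes back. -/
theorem pathSum_downWeight_shift (h : IsRectangleOrbit p q N a b b' F G) (n : ℕ) :
    ∀ t x : ℕ, t + n < N → x + n ≤ p →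
      pathSum (downWeight (F (t + n))) (n + 1) (x + n) q =
        pathSum (downWeight (F t)) 1 x q := by
  induction n with
  | zero => intro t x _ _; rfl
  | succ n ih =>
    intro t x ht hx
    rw [← ih t x (by omega) (by omega)]
    rw [← add_assoc, ← add_assoc,
      pathSum_downWeight_eq (g := G (t + n + 1)) (p := p) (a := a) n.succ_pos
      (h.inv_mul _ (by omega)) (h.bot_right _ (by omega)) (h.top_right _) (h.isUnit_lower _ (by omega))
      (h.isUnit_upper _ (by omega)) (by omega)]
    exact pathSum_congr (m := p) n.succ_pos (h.upWeight_eq_downWeight (by omega)) _ (by omega) _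
      le_rfl

/-- Reciprocity between the lower and the upper edge. -/
theorem reciprocity_edge (h : IsRectangleOrbit p q N a b b' F G) (hq : 0 < q) {a' : K}
    (ha : a * a' = 1) (t i : ℕ) (hi : i < p) (ht : t + i < N) :
    G (t + i + 1) (i + 1) 1 = b' * F t (p - i) q * a' := by
  rw [inverse_label_eq_mul_pathSum (g := G (t + i + 1)) (p := p) (b' := b') hq i.succ_pos hi
    (h.top_left _ ht) (h.top_right _) (h.isUnit_upper _ ht),
    label_eq_pathSum_mul (h.bot_left t) (h.bot_right t (by omega)) (h.isUnit_lower t (by omega)) (p - i)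
      (by omega) q le_rfl,
    pathSum_congr i.succ_pos (h.upWeight_eq_downWeight ht) p le_rfl q le_rfl,
    ← h.pathSum_downWeight_shift i t (p - i) ht (by omega), Nat.sub_add_cancel hi.le, mul_assoc,
    mul_assoc, ha, mul_one]

/-- Induction on `j` from the edge case. The step equation at `(i + 1, j + 1)` and the one at the
antipodal point, taken at an earlier time, mirror each other; all their terms but one are matched by
induction, so the last one matches too. -/
theorem reciprocity (h : IsRectangleOrbit p q N a b b' F G) {a' : K}
    (ha : a * a' = 1) (ha' : a' * a = 1) (j : ℕ) :
    ∀ t i : ℕ, i < p → j < q → t + i + j < N →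
      G (t + i + j + 1) (i + 1) (j + 1) = b' * F t (p - i) (q - j) * a' := by
  induction j using Nat.strong_induction_on with
  | _ j IH =>
  intro t i hi hj ht
  rcases j with _ | j
  · exact h.reciprocity_edge hj ha t i hi ht
  -- the reciprocity for the labels `F`
  have HF : ∀ k < j + 1, ∀ t i : ℕ, i < p → t + i + k < N →
      F (t + i + k + 1) (i + 1) (k + 1) = a * G t (p - i) (q - k) * b := by
    intro k hk t i hi ht
    obtain ⟨x, hx⟩ : ∃ x, p - i = x + 1 := ⟨p - i - 1, by omega⟩
    obtain ⟨y, hy⟩ : ∃ y, q - k = y + 1 := ⟨q - k - 1, by omega⟩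
    have e := IH k hk t i hi (by omega) ht
    rw [hx, hy] at e ⊢
    have e1 : G (t + i + k + 1) (i + 1) (k + 1) * (a * G t (x + 1) (y + 1) * b) = 1 := by
      rw [e]
      calc b' * F t (x + 1) (y + 1) * a' * (a * G t (x + 1) (y + 1) * b)
          = b' * (F t (x + 1) (y + 1) * (a' * a) * G t (x + 1) (y + 1)) * b := by noncomm_ring
        _ = 1 := by
          rw [ha', mul_one, h.mul_inv t (by omega) x (by omega) y (by omega), mul_one,
            h.top_inv_mul]
    exact left_inv_eq_right_inv (h.mul_inv _ (by omega) i hi k (by omega)) e1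
  obtain ⟨x, hx⟩ : ∃ x, p - i = x + 1 := ⟨p - i - 1, by omega⟩
  obtain ⟨y, hy⟩ : ∃ y, q - j = y + 1 := ⟨q - j - 1, by omega⟩
  have hy' : q - (j + 1) = y := by omega
  rw [hx, hy']
  have hT : t + i + (j + 1) = t + i + j + 1 := by ring
  rw [hT] at ht ⊢
  have s1 := h.step (t + i + j + 1) ht i hi j (by omega)
  have g1 : G (t + i + j + 1 + 1) (i + 1) (j + 1) = b' * F (t + 1) (x + 1) (y + 1) * a' := by
    have := IH j (by omega) (t + 1) i hi (by omega) (by omega)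
    rw [hx, hy] at this
    rw [← this]
    congr 1; omega
  have g2 : G (t + i + j + 1) (i + 1) (j + 1) = b' * F t (x + 1) (y + 1) * a' := by
    have := IH j (by omega) t i hi (by omega) (by omega)
    rwa [hx, hy] at this
  have g3 : G (t + i + j + 1 + 1) (i + 2) (j + 1) = b' * F t x (y + 1) * a' := by
    rcases eq_or_lt_of_le (Nat.succ_le_of_lt hi) with hip | hip
    · have e1 : i + 2 = p + 1 := by omega
      have e2 : x = 0 := by omega
      rw [e1, h.top_left _ ht, if_neg (by omega), e2, h.bot_left, mul_zero, zero_mul]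
    · have := IH j (by omega) t (i + 1) hip (by omega) (by omega)
      rw [show p - (i + 1) = x by omega, hy] at this
      rw [← this]
      congr 1; omega
  -- The antipodal map exchanges lower and upper neighbours. Missing neighbours contribute zero on
  -- both sides, except at the corner `i = j = 0`, where the boundary values match as `a = a * b' *
  -- b`.
  have low : F (t + i + j + 1) i (j + 1) + F (t + i + j + 1) (i + 1) j =
      a * (G (t + 1) (x + 2) (y + 1) + G (t + 1) (x + 1) (y + 2)) * b := by
    have l1 : 0 < i → F (t + i + j + 1) i (j + 1) = a * G (t + 1) (x + 2) (y + 1) * b := by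
      intro h0
      have := HF j (by omega) (t + 1) (i - 1) (by omega) (by omega)
      rw [show p - (i - 1) = x + 2 by omega, hy, Nat.sub_add_cancel h0] at this
      rw [← this]
      congr 1; omega
    have l2 : 0 < j → F (t + i + j + 1) (i + 1) j = a * G (t + 1) (x + 1) (y + 2) * b := by
      intro h0
      have := HF (j - 1) (by omega) (t + 1) i hi (by omega)
      rw [show q - (j - 1) = y + 2 by omega, hx, Nat.sub_add_cancel h0] at this
      rw [← this]
      congr 1; omega
    have l3 : j = 0 → G (t + 1) (x + 1) (y + 2) = 0 := by
      intro h0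
      rw [show y + 2 = q + 1 by omega, h.top_right _ _ (by omega)]
    rw [mul_add, add_mul]
    rcases Nat.eq_zero_or_pos i with rfl | hi0
    · rw [show x + 2 = p + 1 by omega, h.top_left _ (by omega), h.bot_left, zero_add]
      rcases Nat.eq_zero_or_pos j with rfl | hj0
      · rw [l3 rfl, h.bot_right _ ht.le, if_pos rfl, if_pos (by omega), mul_assoc, h.top_inv_mul, mul_zero,
          zero_mul, add_zero, mul_one]
      · rw [l2 hj0, if_neg (by omega), mul_zero, zero_mul, zero_add]
    · rw [l1 hi0]
      rcases Nat.eq_zero_or_pos j with rfl | hj0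
      · rw [l3 rfl, h.bot_right _ ht.le, if_neg (by omega), mul_zero, zero_mul]
      · rw [l2 hj0]
  have s0 := h.step t (by omega) x (by omega) y (by omega)
  have m1 := h.inv_mul (t + i + j + 1 + 1) ht i hi j (by omega)
  have m2 := h.mul_inv (t + i + j + 1) (by omega) i hi j (by omega)
  rw [low] at s1
  set U := G (t + 1) (x + 2) (y + 1) + G (t + 1) (x + 1) (y + 2)
  set V := G (t + i + j + 1 + 1) (i + 2) (j + 1) + G (t + i + j + 1 + 1) (i + 1) (j + 2) with hV
  -- The upper sum `V` is isolated in the later step equation; rewriting its other factors produces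
  -- the left side of the earlier equation `s0`.
  have v1 : V = b' * (F t x (y + 1) + F t (x + 1) y) * a' := by
    calc V = (G (t + i + j + 1 + 1) (i + 1) (j + 1) * F (t + i + j + 1 + 1) (i + 1) (j + 1)) * V *
          (F (t + i + j + 1) (i + 1) (j + 1) * G (t + i + j + 1) (i + 1) (j + 1)) := by
          rw [m1, m2, one_mul, mul_one]
      _ = G (t + i + j + 1 + 1) (i + 1) (j + 1) *
          (F (t + i + j + 1 + 1) (i + 1) (j + 1) * V * F (t + i + j + 1) (i + 1) (j + 1)) *
            G (t + i + j + 1) (i + 1) (j + 1) := by noncomm_ring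
      _ = b' * (F (t + 1) (x + 1) (y + 1) * (a' * a) * U * (b * b') * F t (x + 1) (y + 1)) * a' := by
          rw [s1, g1, g2]; noncomm_ring
      _ = _ := by rw [ha', h.top_mul_inv, mul_one, mul_one, s0]
  rw [hV, g3, mul_add, add_mul] at v1
  exact add_left_cancel v1

/-- Twisted periodicity in coordinates. -/
theorem periodicity (h : IsRectangleOrbit p q (p + q) a b b' F G) {a' : K}
    (ha : a * a' = 1) (ha' : a' * a = 1) {i j : ℕ} (hi : i < p) (hj : j < q) :
    F (p + q) (i + 1) (j + 1) = a * b' * F 0 (i + 1) (j + 1) * (a' * b) := by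
  obtain ⟨x, hx⟩ : ∃ x, p = x + i + 1 := ⟨p - i - 1, by omega⟩
  obtain ⟨y, hy⟩ : ∃ y, q = y + j + 1 := ⟨q - j - 1, by omega⟩
  -- The antipodal point `(x + 1, y + 1)` is visited at time `x + y + 1 = p + q - i - j - 1`; the
  -- return takes the remaining `i + j + 1` steps.
  have e1 := h.reciprocity ha ha' j (p + q - i - j - 1) i hi hj (by omega)
  have e2 := h.reciprocity ha ha' y 0 x (by omega) (by omega) (by omega)
  rw [show p - i = x + 1 by omega, show q - j = y + 1 by omega,
    show p + q - i - j - 1 + i + j + 1 = p + q by omega] at e1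
  rw [show p - x = i + 1 by omega, show q - y = j + 1 by omega,
    show 0 + x + y + 1 = p + q - i - j - 1 by omega] at e2
  have m1 := h.mul_inv (p + q) le_rfl i hi j hj
  have m2 := h.inv_mul (p + q - i - j - 1) (by omega) x (by omega) y (by omega)
  have m3 := h.mul_inv (p + q - i - j - 1) (by omega) x (by omega) y (by omega)
  refine left_inv_eq_right_inv m1 ?_
  rw [e1]
  rw [e2] at m3
  calc b' * F (p + q - i - j - 1) (x + 1) (y + 1) * a' *
        (a * b' * F 0 (i + 1) (j + 1) * (a' * b))
      = b' * F (p + q - i - j - 1) (x + 1) (y + 1) * (a' * a) * b' * F 0 (i + 1) (j + 1) *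
        (a' * b) := by noncomm_ring
    _ = b' * (F (p + q - i - j - 1) (x + 1) (y + 1) * (b' * F 0 (i + 1) (j + 1) * a')) * b := by
      rw [ha']; noncomm_ring
    _ = 1 := by rw [m3, mul_one, h.top_inv_mul]

end IsRectangleOrbit

/-! ### Orbits and step equations on a general finite poset. -/

theorem PartialMap.exists_orbit {X : Type*} (R : PartialMap X X) (n : ℕ) (f g : X)
    (h : R.iterate n f = some g) :
    ∃ s : ℕ → X, s 0 = f ∧ s n = g ∧ ∀ t < n, R (s t) = some (s (t + 1)) := by
  induction n generalizing g with
  | zero =>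
    have h : f = g := Option.some_injective _ h
    exact ⟨fun _ => f, rfl, h, fun t ht => absurd ht (Nat.not_lt_zero t)⟩
  | succ n ih =>
    obtain ⟨m, hm, hg⟩ := Option.bind_eq_some_iff.mp h
    obtain ⟨s, h0, hn, hs⟩ := ih m hm
    refine ⟨fun t => if t ≤ n then s t else g, ?_, ?_, fun t ht => ?_⟩
    · simpa using h0
    · simp
    · simp only [if_pos (Nat.le_of_lt_succ ht)]
      rcases eq_or_lt_of_le (Nat.le_of_lt_succ ht) with rfl | h1
      · rw [if_neg (by omega), hn, hg]
      · rw [if_pos (by omega), hs t h1]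

section General

theorem toHat_covBy_toHat {P : Type*} [PartialOrder P] {u v : P} : toHat u ⋖ toHat v ↔ u ⋖ v := by
  simp [toHat]

open Classical in
theorem sum_hat {P K : Type*} [Fintype P] [Ring K] (h : Hat P → K) : ∑ u, h u = h ⊥ + (h ⊤ + ∑ u : P, h (toHat u)) :=
  (Fintype.sum_option h).trans
    (congrArg _ (Fintype.sum_option fun u : WithTop P => h ((u : WithTop P) : Hat P)))

variable {P K : Type*} [PartialOrder P] [Fintype P] [Ring K]

theorem toggle_eq_some {v : P} {f g : Labeling P K} (h : toggle v f = some g) :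
    ToggleDefined f (toHat v) ∧ (∀ w, w ≠ toHat v → g w = f w) ∧
      g (toHat v) = lowerSum f (toHat v) * Ring.inverse (f (toHat v)) *
        Ring.inverse (upperInvSum f (toHat v)) := by
  unfold toggle at h
  split_ifs at h with hd
  have h := Option.some_injective _ h
  subst h
  exact ⟨hd, fun w hw => if_neg hw, if_pos rfl⟩

theorem lowerSum_congr {f g : Labeling P K} {v : Hat P} (h : ∀ u, u ⋖ v → f u = g u) :
    lowerSum f v = lowerSum g v :=
  Finset.sum_congr rfl fun u hu => h u (by simpa using hu)

theorem upperInvSum_congr {f g : Labeling P K} {v : Hat P} (h : ∀ u, v ⋖ u → f u = g u) :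
    upperInvSum f v = upperInvSum g v :=
  Finset.sum_congr rfl fun u hu => congrArg _ (h u (by simpa using hu))

/-- The transition equation of rowmotion from `f` to `g` at `v`, together with the invertibility
of everything that is inverted in it. -/
structure IsTransition (f g : Labeling P K) (v : P) : Prop where
  isUnit_label : IsUnit (f (toHat v))
  isUnit_above : ∀ u, toHat v ⋖ u → IsUnit (g u)
  isUnit_upperInvSum : IsUnit (upperInvSum g (toHat v))
  label_eq : g (toHat v) = lowerSum f (toHat v) * Ring.inverse (f (toHat v)) *
    Ring.inverse (upperInvSum g (toHat v))

/-- Toggles act from the end of the list, hence from the top of the poset down: when `v` is toggled,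
everything below it still carries `f` and everything above it already carries `g`. -/
theorem toggleList_isTransition (l : List P) (hn : l.Nodup)
    (hl : l.Pairwise (fun x y => ¬ y < x)) (f g : Labeling P K) (h : toggleList l f = some g) :
    (∀ w, (∀ v ∈ l, w ≠ toHat v) → g w = f w) ∧ ∀ v ∈ l, IsTransition f g v := by
  induction l generalizing g with
  | nil =>
    have h : f = g := Option.some_injective _ h
    subst h
    simp
  | cons v l ih =>
    obtain ⟨m, hm, hg⟩ := Option.bind_eq_some_iff.mp h
    rw [List.nodup_cons] at hn
    rw [List.pairwise_cons] at hl
    obtain ⟨ih1, ih2⟩ := ih hn.2 hl.2 m hm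
    obtain ⟨hd, h1, h2⟩ := toggle_eq_some hg
    have hv : m (toHat v) = f (toHat v) := ih1 _ fun w hw e => hn.1 (toHat_injective e ▸ hw)
    have hlow : lowerSum m (toHat v) = lowerSum f (toHat v) := by
      refine lowerSum_congr fun u hu => ih1 u fun w hw e => ?_
      subst e
      exact hl.1 w hw (toHat_lt.mp hu.lt)
    have hup : ∀ w, ¬ w < v → ∀ u, toHat w ⋖ u → g u = m u := by
      intro w hw u hu
      refine h1 u fun e => ?_
      subst e
      exact hw (toHat_lt.mp hu.lt)
    have hupv := hup v (lt_irrefl v)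
    refine ⟨fun w hw => ?_, fun w hw => ?_⟩
    · rw [h1 w (hw v List.mem_cons_self), ih1 w fun u hu => hw u (List.mem_cons_of_mem _ hu)]
    · rcases List.mem_cons.mp hw with rfl | hw
      · refine ⟨hv ▸ hd.1, fun u hu => ?_, ?_, ?_⟩
        · rw [hupv u hu]
          exact hd.2.1 u hu
        · rw [upperInvSum_congr hupv]
          exact hd.2.2
        · rw [h2, hlow, hv, upperInvSum_congr hupv]
      · have hupw := hup w (hl.1 w hw)
        have hne : w ≠ v := fun e => hn.1 (e ▸ hw)
        obtain ⟨a1, a2, a3, a4⟩ := ih2 w hw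
        refine ⟨a1, fun u hu => ?_, ?_, ?_⟩
        · rw [hupw u hu]
          exact a2 u hu
        · rw [upperInvSum_congr hupw]
          exact a3
        · rw [h1 _ fun e => hne (toHat_injective e), a4, upperInvSum_congr hupw]

theorem rowmotion_eq_some {f g : Labeling P K} (h : rowmotion P K f = some g) :
    g ⊥ = f ⊥ ∧ g ⊤ = f ⊤ ∧ ∀ v, IsTransition f g v := by
  obtain ⟨l, hl⟩ := exists_isLinearExtension P
  rw [rowmotion_eq_toggleList hl] at h
  obtain ⟨h1, h2⟩ := toggleList_isTransition l hl.nodup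
    ((isLinearExtension_index_iff l).mp hl.index_lt) f g h
  refine ⟨h1 _ fun v _ => ?_, h1 _ fun v _ => ?_, fun v => h2 v (hl.mem_all v)⟩
  · exact WithBot.bot_ne_coe
  · exact fun e => WithTop.top_ne_coe (WithBot.coe_injective e)

theorem IsTransition.mul_mul_eq {f g : Labeling P K} {v : P} (h : IsTransition f g v) :
    g (toHat v) * upperInvSum g (toHat v) * f (toHat v) = lowerSum f (toHat v) := by
  rw [h.label_eq, mul_assoc _ _ (upperInvSum g _), Ring.inverse_mul_cancel _ h.isUnit_upperInvSum,
    mul_one, mul_assoc, Ring.inverse_mul_cancel _ h.isUnit_label, mul_one]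

theorem IsTransition.isUnit_lowerSum {f g : Labeling P K} {v : P} (h : IsTransition f g v)
    (hg : IsUnit (g (toHat v))) : IsUnit (lowerSum f (toHat v)) := by
  rw [← h.mul_mul_eq]
  exact (hg.mul h.isUnit_upperInvSum).mul h.isUnit_label

theorem IsTransition.isUnit_next {f g : Labeling P K} {v : P} (h : IsTransition f g v)
    (hf : IsUnit (lowerSum f (toHat v))) : IsUnit (g (toHat v)) := by
  rw [h.label_eq]
  exact (hf.mul h.isUnit_label.ringInverse).mul h.isUnit_upperInvSum.ringInverse

theorem isMin_withTop_coe {P : Type*} [PartialOrder P] {v : P} :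
    IsMin (v : WithTop P) ↔ IsMin v := by
  refine ⟨fun h u hu => WithTop.coe_le_coe.mp (h (WithTop.coe_le_coe.mpr hu)), fun h u hu => ?_⟩
  obtain ⟨w, rfl, hw⟩ := WithTop.le_coe_iff.mp hu
  exact WithTop.coe_le_coe.mpr (h hw)

open Classical in
theorem lowerSum_toHat (f : Labeling P K) (v : P) :
    lowerSum f (toHat v) =
      (if IsMin v then f ⊥ else 0) + ∑ u : P, if u ⋖ v then f (toHat u) else 0 := by
  have e : ¬ (⊤ : Hat P) ⋖ toHat v := fun h => not_top_lt h.lt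
  have e' : (⊥ : Hat P) ⋖ toHat v ↔ IsMin v :=
    WithBot.bot_covBy_coe.trans isMin_withTop_coe
  rw [lowerSum, Finset.sum_filter, sum_hat, if_neg e, zero_add]
  simp only [toHat_covBy_toHat, e']

open Classical in
theorem upperInvSum_toHat (f : Labeling P K) (v : P) :
    upperInvSum f (toHat v) = (if IsMax v then Ring.inverse (f ⊤) else 0) +
      ∑ u : P, if v ⋖ u then Ring.inverse (f (toHat u)) else 0 := by
  have e : ¬ toHat v ⋖ (⊥ : Hat P) := fun h => not_lt_bot h.lt
  have e' : toHat v ⋖ (⊤ : Hat P) ↔ IsMax v :=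
    WithBot.coe_covBy_coe.trans WithTop.coe_covBy_top
  rw [upperInvSum, Finset.sum_filter, sum_hat, if_neg e, zero_add]
  simp only [toHat_covBy_toHat, e']

end General

/-! ### Translation of the rectangle into coordinates. -/

section Rectangle

variable {K : Type*} [Ring K] {p q : ℕ}

theorem fin_covBy_iff {n : ℕ} {a b : Fin n} : a ⋖ b ↔ a.val + 1 = b.val := by
  refine ⟨fun h => ?_, fun h => ⟨Fin.lt_def.mpr (by omega), fun c h1 h2 => ?_⟩⟩
  · by_contra hne
    have hlt : a.val < b.val := h.lt
    exact h.2 (c := ⟨a.val + 1, by omega⟩) (Fin.lt_def.mpr (by simp))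
      (Fin.lt_def.mpr (by simp only; omega))
  · have h1 : a.val < c.val := h1
    have h2 : c.val < b.val := h2
    omega

theorem fin_isMin_iff {n : ℕ} {a : Fin n} : IsMin a ↔ a.val = 0 := by
  refine ⟨fun h => ?_, fun h b _ => Fin.le_def.mpr (by omega)⟩
  have : a.val ≤ 0 := h (b := ⟨0, a.pos⟩) (Fin.le_def.mpr (Nat.zero_le _))
  omega

theorem fin_isMax_iff {n : ℕ} {a : Fin n} : IsMax a ↔ a.val + 1 = n := by
  refine ⟨fun h => ?_, fun h b _ => Fin.le_def.mpr (by omega)⟩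
  have ha := a.isLt
  have : n - 1 ≤ a.val := h (b := ⟨n - 1, by omega⟩) (Fin.le_def.mpr (by simp only; omega))
  omega

/-- The coordinate form of a function on the rectangle, with 1-based coordinates, extended by
zero. -/
def extendZero (h : Fin p × Fin q → K) : ℕ → ℕ → K
  | i + 1, j + 1 => if H : i < p ∧ j < q then h (⟨i, H.1⟩, ⟨j, H.2⟩) else 0
  | _, _ => 0

theorem extendZero_succ_succ (h : Fin p × Fin q → K) {i j : ℕ} (hi : i < p) (hj : j < q) :
    extendZero h (i + 1) (j + 1) = h (⟨i, hi⟩, ⟨j, hj⟩) := dif_pos ⟨hi, hj⟩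

theorem extendZero_zero_left (h : Fin p × Fin q → K) (j : ℕ) : extendZero h 0 j = 0 := rfl

theorem extendZero_zero_right (h : Fin p × Fin q → K) (i : ℕ) : extendZero h i 0 = 0 := by
  cases i <;> rfl

theorem extendZero_of_le_left (h : Fin p × Fin q → K) {i : ℕ} (hi : p < i) (j : ℕ) :
    extendZero h i j = 0 := by
  rcases i with _ | i
  · rfl
  · rcases j with _ | j
    · rfl
    · exact dif_neg fun H => by omega

theorem extendZero_of_le_right (h : Fin p × Fin q → K) (i : ℕ) {j : ℕ} (hj : q < j) :
    extendZero h i j = 0 := by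
  rcases i with _ | i
  · rfl
  · rcases j with _ | j
    · rfl
    · exact dif_neg fun H => by omega

theorem sum_fin_ite_add_one_eq {n : ℕ} (h : Fin n → K) (c : ℕ) (v : K)
    (h0 : ∀ m : Fin n, m.val + 1 = c → h m = v) (h1 : (∀ m : Fin n, m.val + 1 ≠ c) → v = 0) :
    ∑ m : Fin n, (if m.val + 1 = c then h m else 0) = v := by
  by_cases hc : ∃ m : Fin n, m.val + 1 = c
  · obtain ⟨m, hm⟩ := hc
    rw [Finset.sum_eq_single m, if_pos hm, h0 m hm]
    · intro b _ hb
      exact if_neg fun h => hb (Fin.ext (by omega))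
    · exact fun h => absurd (Finset.mem_univ m) h
  · push Not at hc
    rw [h1 hc]
    exact Finset.sum_eq_zero fun m _ => if_neg (hc m)

theorem sum_fin_ite_eq_add_one {n : ℕ} (h : Fin n → K) (c : ℕ) (v : K)
    (h0 : ∀ m : Fin n, c + 1 = m.val → h m = v) (h1 : (∀ m : Fin n, c + 1 ≠ m.val) → v = 0) :
    ∑ m : Fin n, (if c + 1 = m.val then h m else 0) = v := by
  by_cases hc : ∃ m : Fin n, c + 1 = m.val
  · obtain ⟨m, hm⟩ := hc
    rw [Finset.sum_eq_single m, if_pos hm, h0 m hm]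
    · intro b _ hb
      exact if_neg fun h => hb (Fin.ext (by omega))
    · exact fun h => absurd (Finset.mem_univ m) h
  · push Not at hc
    rw [h1 hc]
    exact Finset.sum_eq_zero fun m _ => if_neg (hc m)

-- A cover in a product of chains lowers exactly one coordinate by one; the extension by zero
-- absorbs the neighbours that do not exist.
open Classical in
theorem sum_covBy (h : Fin p × Fin q → K) {i j : ℕ} (hi : i < p) (hj : j < q) :
    ∑ u, (if u ⋖ ((⟨i, hi⟩, ⟨j, hj⟩) : Fin p × Fin q) then h u else 0) =
      extendZero h i (j + 1) + extendZero h (i + 1) j := by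
  have e : ∀ (a : Fin p) (b : Fin q),
      (if (a, b) ⋖ ((⟨i, hi⟩, ⟨j, hj⟩) : Fin p × Fin q) then h (a, b) else 0) =
        (if b = ⟨j, hj⟩ then if a.val + 1 = i then h (a, b) else 0 else 0) +
        (if a = ⟨i, hi⟩ then if b.val + 1 = j then h (a, b) else 0 else 0) := by
    intro a b
    rw [Prod.mk_covBy_mk_iff, fin_covBy_iff, fin_covBy_iff]
    by_cases h1 : b = ⟨j, hj⟩ <;> by_cases h2 : a = ⟨i, hi⟩ <;> simp [h1, h2]
  rw [Fintype.sum_prod_type]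
  simp only [e, Finset.sum_add_distrib]
  congr 1
  · simp only [Finset.sum_ite_eq', Finset.mem_univ, if_true]
    refine sum_fin_ite_add_one_eq _ _ _ ?_ fun hm => ?_
    · rintro m rfl
      rw [extendZero_succ_succ _ m.isLt hj]
    · rcases i with _ | i
      · rfl
      · exact absurd rfl (hm ⟨i, by omega⟩)
  · rw [Finset.sum_comm]
    simp only [Finset.sum_ite_eq', Finset.mem_univ, if_true]
    refine sum_fin_ite_add_one_eq _ _ _ ?_ fun hm => ?_
    · rintro m rfl
      rw [extendZero_succ_succ _ hi m.isLt]
    · rcases j with _ | j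
      · rfl
      · exact absurd rfl (hm ⟨j, by omega⟩)

open Classical in
theorem sum_covBy' (h : Fin p × Fin q → K) {i j : ℕ} (hi : i < p) (hj : j < q) :
    ∑ u, (if ((⟨i, hi⟩, ⟨j, hj⟩) : Fin p × Fin q) ⋖ u then h u else 0) =
      extendZero h (i + 2) (j + 1) + extendZero h (i + 1) (j + 2) := by
  have e : ∀ (a : Fin p) (b : Fin q),
      (if ((⟨i, hi⟩, ⟨j, hj⟩) : Fin p × Fin q) ⋖ (a, b) then h (a, b) else 0) =
        (if ⟨j, hj⟩ = b then if i + 1 = a.val then h (a, b) else 0 else 0) +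
        (if ⟨i, hi⟩ = a then if j + 1 = b.val then h (a, b) else 0 else 0) := by
    intro a b
    rw [Prod.mk_covBy_mk_iff, fin_covBy_iff, fin_covBy_iff]
    by_cases h1 : ⟨j, hj⟩ = b <;> by_cases h2 : ⟨i, hi⟩ = a
    · subst h1 h2; simp
    · subst h1; simp [h2]
    · subst h2; simp [h1]
    · simp [h1, h2]
  rw [Fintype.sum_prod_type]
  simp only [e, Finset.sum_add_distrib]
  congr 1
  · simp only [Finset.sum_ite_eq, Finset.mem_univ, if_true]
    refine sum_fin_ite_eq_add_one _ _ _ ?_ fun hm => ?_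
    · rintro ⟨m, hm⟩ h
      simp only at h
      subst h
      rw [extendZero_succ_succ _ hm hj]
    · exact extendZero_of_le_left _ (Nat.lt_succ_of_le (not_lt.mp fun h => hm ⟨i + 1, h⟩ rfl)) _
  · rw [Finset.sum_comm]
    simp only [Finset.sum_ite_eq, Finset.mem_univ, if_true]
    refine sum_fin_ite_eq_add_one _ _ _ ?_ fun hm => ?_
    · rintro ⟨m, hm⟩ h
      simp only at h
      subst h
      rw [extendZero_succ_succ _ hi hm]
    · exact extendZero_of_le_right _ _ (Nat.lt_succ_of_le (not_lt.mp fun h => hm ⟨j + 1, h⟩ rfl))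

/-- The labels in coordinates, with the bottom label placed at `(1, 0)`. -/
noncomputable def labelCoord (f : Labeling (Fin p × Fin q) K) (i j : ℕ) : K :=
  extendZero (fun u => f (toHat u)) i j + if i = 1 ∧ j = 0 then f ⊥ else 0

/-- The inverse labels in coordinates, with the inverse of the top label placed at
`(p + 1, q)`. -/
noncomputable def inverseLabelCoord (f : Labeling (Fin p × Fin q) K) (i j : ℕ) : K :=
  extendZero (fun u => Ring.inverse (f (toHat u))) i j +
    if i = p + 1 ∧ j = q then Ring.inverse (f ⊤) else 0

theorem lowerSum_eq_labelCoord (f : Labeling (Fin p × Fin q) K) {i j : ℕ}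
    (hi : i < p) (hj : j < q) :
    lowerSum f (toHat (⟨i, hi⟩, ⟨j, hj⟩)) = labelCoord f i (j + 1) + labelCoord f (i + 1) j := by
  classical
  have e : IsMin ((⟨i, hi⟩, ⟨j, hj⟩) : Fin p × Fin q) ↔ i + 1 = 1 ∧ j = 0 := by
    rw [Prod.isMin_iff, fin_isMin_iff, fin_isMin_iff]
    simp
  rw [lowerSum_toHat, sum_covBy (fun u => f (toHat u)) hi hj, labelCoord, labelCoord,
    if_neg (by omega : ¬ (i = 1 ∧ j + 1 = 0)), add_zero, add_comm, add_assoc]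
  simp only [e]

theorem upperInvSum_eq_inverseLabelCoord (f : Labeling (Fin p × Fin q) K) {i j : ℕ}
    (hi : i < p) (hj : j < q) :
    upperInvSum f (toHat (⟨i, hi⟩, ⟨j, hj⟩)) =
      inverseLabelCoord f (i + 2) (j + 1) + inverseLabelCoord f (i + 1) (j + 2) := by
  classical
  have e : IsMax ((⟨i, hi⟩, ⟨j, hj⟩) : Fin p × Fin q) ↔ i + 2 = p + 1 ∧ j + 1 = q := by
    rw [Prod.isMax_iff, fin_isMax_iff, fin_isMax_iff]
    simp only
    omega
  rw [upperInvSum_toHat, sum_covBy' (fun u => Ring.inverse (f (toHat u))) hi hj,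
    inverseLabelCoord, inverseLabelCoord, if_neg (by omega : ¬ (i + 1 = p + 1 ∧ j + 2 = q)),
    add_zero, add_comm, add_right_comm]
  simp only [e]

theorem labelCoord_succ_succ (f : Labeling (Fin p × Fin q) K) {i j : ℕ}
    (hi : i < p) (hj : j < q) :
    labelCoord f (i + 1) (j + 1) = f (toHat (⟨i, hi⟩, ⟨j, hj⟩)) := by
  rw [labelCoord, extendZero_succ_succ _ hi hj, if_neg (by omega), add_zero]

theorem inverseLabelCoord_succ_succ (f : Labeling (Fin p × Fin q) K) {i j : ℕ}
    (hi : i < p) (hj : j < q) :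
    inverseLabelCoord f (i + 1) (j + 1) = Ring.inverse (f (toHat (⟨i, hi⟩, ⟨j, hj⟩))) := by
  rw [inverseLabelCoord, extendZero_succ_succ _ hi hj, if_neg (by omega), add_zero]

/-- In an orbit of rowmotion the extreme labels do not change. -/
theorem orbit_bot_top {P : Type*} [PartialOrder P] [Fintype P] {N : ℕ} {s : ℕ → Labeling P K}
    (hs : ∀ t < N, rowmotion P K (s t) = some (s (t + 1))) :
    ∀ t ≤ N, s t ⊥ = s 0 ⊥ ∧ s t ⊤ = s 0 ⊤ := by
  intro t
  induction t with
  | zero => exact fun _ => ⟨rfl, rfl⟩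
  | succ t ih =>
    intro ht
    obtain ⟨h1, h2, _⟩ := rowmotion_eq_some (hs t ht)
    exact ⟨h1.trans (ih (by omega)).1, h2.trans (ih (by omega)).2⟩

theorem lowerSum_corner (f : Labeling (Fin p × Fin q) K) (hp : 0 < p) (hq : 0 < q) :
    lowerSum f (toHat (⟨0, hp⟩, ⟨0, hq⟩)) = f ⊥ := by
  rw [lowerSum_eq_labelCoord, labelCoord, labelCoord, extendZero_zero_left, zero_add,
    extendZero_zero_right, if_neg (by omega), if_pos ⟨rfl, rfl⟩, zero_add, zero_add]

theorem isUnit_top {f g : Labeling (Fin p × Fin q) K} (hp : 0 < p) (hq : 0 < q)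
    (h : ∀ v, IsTransition f g v) : IsUnit (g ⊤) := by
  refine (h (⟨p - 1, by omega⟩, ⟨q - 1, by omega⟩)).isUnit_above ⊤
    (WithBot.coe_covBy_coe.mpr (WithTop.coe_covBy_top.mpr ?_))
  rw [Prod.isMax_iff, fin_isMax_iff, fin_isMax_iff]
  exact ⟨Nat.sub_add_cancel hp, Nat.sub_add_cancel hq⟩

/-- After a step of rowmotion every label is invertible, if the bottom label is. -/
theorem isUnit_of_transition {f g : Labeling (Fin p × Fin q) K}
    (h : ∀ v, IsTransition f g v) (hb : IsUnit (f ⊥)) (v : Fin p × Fin q) :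
    IsUnit (g (toHat v)) := by
  obtain ⟨⟨i, hi⟩, ⟨j, hj⟩⟩ := v
  -- An element other than the minimal corner covers an element of the rectangle, whose toggle
  -- inverts its new label. At the corner the new label is a product of units.
  rcases i with _ | i
  · rcases j with _ | j
    · refine (h _).isUnit_next ?_
      rwa [lowerSum_corner]
    · refine (h (⟨0, hi⟩, ⟨j, by omega⟩)).isUnit_above _ (toHat_covBy_toHat.mpr ?_)
      exact Prod.mk_covBy_mk_iff_right.mpr (fin_covBy_iff.mpr rfl)
  · refine (h (⟨i, by omega⟩, ⟨j, hj⟩)).isUnit_above _ (toHat_covBy_toHat.mpr ?_)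
    exact Prod.mk_covBy_mk_iff_left.mpr (fin_covBy_iff.mpr rfl)

/-- Two steps are needed for the bottom label: it is the lower sum at the minimal corner, a unit
once the corner's label after one step is, and that label is inverted only in the second step. -/
theorem isRectangleOrbit {N : ℕ} {s : ℕ → Labeling (Fin p × Fin q) K} (hp : 0 < p) (hq : 0 < q)
    (hN : 2 ≤ N) (hs : ∀ t < N, rowmotion (Fin p × Fin q) K (s t) = some (s (t + 1))) :
    IsUnit (s 0 ⊥) ∧ IsUnit (s 0 ⊤) ∧
      IsRectangleOrbit p q N (s 0 ⊥) (s 0 ⊤) (Ring.inverse (s 0 ⊤))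
        (fun t => labelCoord (s t)) (fun t => inverseLabelCoord (s t)) := by
  have hst := fun t ht => (rowmotion_eq_some (hs t ht)).2.2
  have hconst := orbit_bot_top hs
  have hbot : IsUnit (s 0 ⊥) := by
    rw [← lowerSum_corner (s 0) hp hq]
    exact (hst 0 (by omega) _).isUnit_lowerSum (hst 1 (by omega) _).isUnit_label
  have htop : IsUnit (s 0 ⊤) := by
    rw [← (hconst 1 (by omega)).2]
    exact isUnit_top hp hq (hst 0 (by omega))
  have hunit : ∀ t ≤ N, ∀ v, IsUnit (s t (toHat v)) := by
    intro t ht v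
    rcases t with _ | t
    · exact (hst 0 (by omega) v).isUnit_label
    · exact isUnit_of_transition (hst t ht) ((hconst t (by omega)).1 ▸ hbot) v
  refine ⟨hbot, htop, ⟨?_, ?_, ?_, ?_, ?_, ?_, Ring.mul_inverse_cancel _ htop,
    Ring.inverse_mul_cancel _ htop, ?_, ?_, ?_⟩⟩
  · intro t ht x hx y hy
    simp only [labelCoord_succ_succ _ hx hy, inverseLabelCoord_succ_succ _ hx hy]
    exact Ring.mul_inverse_cancel _ (hunit t ht _)
  · intro t ht x hx y hy
    simp only [labelCoord_succ_succ _ hx hy, inverseLabelCoord_succ_succ _ hx hy]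
    exact Ring.inverse_mul_cancel _ (hunit t ht _)
  · intro t y
    simp [labelCoord, extendZero_zero_left]
  · intro t ht x
    simp [labelCoord, extendZero_zero_right, (hconst t ht).1]
  · intro t ht y
    simp [inverseLabelCoord, extendZero_of_le_left _ (Nat.lt_succ_self p), (hconst t ht).2]
  · intro t x hx
    simp [inverseLabelCoord, extendZero_of_le_right _ _ (Nat.lt_succ_self q)]
  · intro t ht x hx y hy
    simp only [← lowerSum_eq_labelCoord _ hx hy]
    exact (hst t ht _).isUnit_lowerSum (hunit _ ht _)
  · intro t ht x hx y hy
    simp only [← upperInvSum_eq_inverseLabelCoord _ hx hy]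
    exact (hst t ht _).isUnit_upperInvSum
  · intro t ht x hx y hy
    simp only [← lowerSum_eq_labelCoord _ hx hy, ← upperInvSum_eq_inverseLabelCoord _ hx hy,
      labelCoord_succ_succ _ hx hy]
    exact (hst t ht _).mul_mul_eq

end Rectangle
end NoncommRowmotion

/-! ### The twisted periodicity theorem. -/

theorem mainTheorem1 {K : Type*} [Ring K] (p q : ℕ) (hp : 0 < p) (hq : 0 < q)
    (f g : NoncommRowmotion.Labeling (Fin p × Fin q) K)
    (hg : (NoncommRowmotion.rowmotion (Fin p × Fin q) K).iterate (p + q) f = some g)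
    (a b : K) (ha : a = f ⊥) (hb : b = f ⊤) :
    IsUnit a ∧ IsUnit b ∧
      ∀ x : NoncommRowmotion.Hat (Fin p × Fin q),
        g x = (a * Ring.inverse b) * f x * (Ring.inverse a * b) := by
  obtain ⟨s, rfl, rfl, hs⟩ := NoncommRowmotion.PartialMap.exists_orbit _ _ _ _ hg
  obtain ⟨ua, ub, h⟩ := NoncommRowmotion.isRectangleOrbit hp hq (by omega) hs
  obtain ⟨e0, e1⟩ := NoncommRowmotion.orbit_bot_top hs (p + q) le_rfl
  rw [← ha] at ua h e0
  rw [← hb] at ub h e1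
  refine ⟨ua, ub, fun x => ?_⟩
  -- At the two adjoined elements the label is constant along the orbit and the twist cancels.
  induction x using WithBot.recBotCoe with
  | bot =>
    rw [e0, ← ha, mul_assoc, ← mul_assoc a (Ring.inverse a), Ring.mul_inverse_cancel _ ua, one_mul,
      mul_assoc, Ring.inverse_mul_cancel _ ub, mul_one]
  | coe x =>
    induction x using WithTop.recTopCoe with
    | top =>
      change s (p + q) ⊤ = a * Ring.inverse b * s 0 ⊤ * (Ring.inverse a * b)
      rw [e1, ← hb, mul_assoc a, Ring.inverse_mul_cancel _ ub, mul_one, ← mul_assoc,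
        Ring.mul_inverse_cancel _ ua, one_mul]
    | coe v =>
      obtain ⟨⟨i, hi⟩, ⟨j, hj⟩⟩ := v
      have := h.periodicity (Ring.mul_inverse_cancel _ ua) (Ring.inverse_mul_cancel _ ua) hi hj
      simp only [NoncommRowmotion.labelCoord_succ_succ _ hi hj] at this
      exact this
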